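/- Let $G$ be a finite simple graph. In the domination game on $G$ two players, Dominator and Staller, alternately choose vertices of $G$. A vertex $v$ dominates itself and its neighbours, and each chosen vertex must dominate at least one vertex not dominated by the vertices chosen before it. The game ends when all vertices of $G$ are dominated. Dominator wants the total number of chosen vertices to be as small as possible, and Staller wants it to be as large as possible. Let $\gamma_g(G)$ (respectively $\gamma_g'(G)$) denote the total number of vertices chosen under optimal play by both players when Dominator (respectively Staller) makes the first move. Theorem. There is no finite tree $T$ with $(\gamma_g(T),\gamma_g'(T))=(3,2)$, and there is no finite tree $T$ with $(\gamma_g(T),\gamma_g'(T))=(4,3)$. -/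

import Mathlib

namespace DominationGame

variable {V : Type*} [Fintype V]

/-- The two players of the domination game. -/
inductive Player where
  | dominator
  | staller

open Classical in
/-- The closed neighbourhood `N[v]`: the set of vertices dominated by `v`. -/
noncomputable def closedNbhd (G : SimpleGraph V) (v : V) : Finset V :=
  Finset.univ.filter fun u => u = v ∨ G.Adj v u

open Classical in
/-- The legal moves when exactly the vertices of `A` are already dominated: the vertices `v` that
dominate at least one vertex outside `A`. -/
noncomputable def legalMoves (G : SimpleGraph V) (A : Finset V) : Finset V :=
  Finset.univ.filter fun v => ¬ closedNbhd G v ⊆ A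

open Classical in
/-- The set of dominated vertices after `v` is chosen, if `A` was dominated before. -/
noncomputable def afterMove (G : SimpleGraph V) (A : Finset V) (v : V) : Finset V :=
  A ∪ closedNbhd G v

theorem mem_closedNbhd (G : SimpleGraph V) (v u : V) :
    u ∈ closedNbhd G v ↔ u = v ∨ G.Adj v u := by
  simp [closedNbhd]

theorem mem_legalMoves (G : SimpleGraph V) (A : Finset V) (v : V) :
    v ∈ legalMoves G A ↔ ¬ closedNbhd G v ⊆ A := by
  simp [legalMoves]

theorem mem_afterMove (G : SimpleGraph V) (A : Finset V) (v u : V) :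
    u ∈ afterMove G A v ↔ u ∈ A ∨ u ∈ closedNbhd G v := by
  simp [afterMove]

/-- There is a legal move precisely when some vertex is still undominated. -/
theorem legalMoves_nonempty_iff (G : SimpleGraph V) (A : Finset V) :
    (legalMoves G A).Nonempty ↔ A ≠ Finset.univ := by
  constructor
  · rintro ⟨v, hv⟩ rfl
    exact (mem_legalMoves G _ v).1 hv (Finset.subset_univ _)
  · intro h
    obtain ⟨u, hu⟩ : ∃ u, u ∉ A := by
      by_contra hc
      push Not at hc
      exact h (Finset.eq_univ_of_forall hc)
    exact ⟨u, (mem_legalMoves G A u).2 fun hs => hu (hs ((mem_closedNbhd G u u).2 (Or.inl rfl)))⟩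

/-- A legal move strictly enlarges the set of dominated vertices. -/
theorem ssubset_afterMove (G : SimpleGraph V) (A : Finset V) (v : V) (hv : v ∈ legalMoves G A) :
    A ⊂ afterMove G A v := by
  refine Finset.ssubset_iff_subset_ne.2 ⟨fun u hu => (mem_afterMove G A v u).2 (Or.inl hu), ?_⟩
  intro h
  refine (mem_legalMoves G A v).1 hv fun u hu => ?_
  rw [h]
  exact (mem_afterMove G A v u).2 (Or.inr hu)

theorem undominated_decreases (G : SimpleGraph V) (A : Finset V) (v : V)
    (hv : v ∈ legalMoves G A) :
    Fintype.card V - (afterMove G A v).card < Fintype.card V - A.card := by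
  have h1 := Finset.card_lt_card (ssubset_afterMove G A v hv)
  have h2 := Finset.card_le_univ (afterMove G A v)
  omega

/-- The number of moves still to be made under optimal play on `G`, when the vertices of `A` are
already dominated and the given player is next to move. Dominator minimizes and Staller maximizes
this number; the game ends when there is no legal move. -/
noncomputable def movesLeft (G : SimpleGraph V) (p : Player) (A : Finset V) : ℕ :=
  if h : (legalMoves G A).Nonempty then
    match p with
    | .dominator => 1 + (legalMoves G A).attach.inf' (Finset.attach_nonempty_iff.2 h)
        (fun v => movesLeft G .staller (afterMove G A v.1))
    | .staller => 1 + (legalMoves G A).attach.sup' (Finset.attach_nonempty_iff.2 h)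
        (fun v => movesLeft G .dominator (afterMove G A v.1))
  else 0
termination_by Fintype.card V - A.card
decreasing_by
  · exact undominated_decreases G A v.1 v.2
  · exact undominated_decreases G A v.1 v.2

/-- The game domination number `γ_g(G)`: Dominator starts, no vertex is dominated yet. -/
noncomputable def gameDominationNumber (G : SimpleGraph V) : ℕ :=
  movesLeft G .dominator ∅

/-- The Staller-start game domination number `γ_g'(G)`. -/
noncomputable def stallerStartGameDominationNumber (G : SimpleGraph V) : ℕ :=
  movesLeft G .staller ∅

/-- `G` realizes the pair `(r, s)`. -/
def Realizes (G : SimpleGraph V) (r s : ℕ) : Prop :=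
  gameDominationNumber G = r ∧ stallerStartGameDominationNumber G = s

end DominationGame

/-! If γ_g' ≤ 2, every vertex has a partner with which it dominates the tree; if γ_g' ≤ 3, every
vertex has a partner with which it misses at most one vertex. Applied to a leaf, this forces the
partner to dominate almost everything. In the first case some single vertex then misses at most one
vertex, so γ_g ≤ 2 (`exists_dominates_all_but_one`); in the second some pair dominates, so γ_g ≤ 3
(`exists_dominating_pair`). A nontrivial tree enters only through connectedness, a leaf, and the
absence of triangles and four-cycles. -/

namespace DominationGame

/-! ### Domination in connected graphs of girth at least five with a leaf -/

section Graph

variable {V : Type*} {G : SimpleGraph V}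

/-- `G` has neither triangles nor four-cycles. -/
structure GirthAtLeastFive (G : SimpleGraph V) : Prop where
  triangle : ∀ {a b c : V}, G.Adj a b → G.Adj b c → ¬ G.Adj a c
  square : ∀ {a b c d : V}, G.Adj a b → G.Adj b c → G.Adj a d → G.Adj d c → a ≠ c → b = d

/-- Either configuration would give two distinct paths from `a` to `c`. -/
theorem girthAtLeastFive_of_isAcyclic (hG : G.IsAcyclic) : GirthAtLeastFive G where
  triangle {a b c} hab hbc hac := by
    have h := (hG.subsingleton_path _ _).elim
      (⟨.cons hab (.cons hbc .nil), by simp [hab.ne, hbc.ne, hac.ne]⟩ : G.Path a c)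
      ⟨.cons hac .nil, by simp [hac.ne]⟩
    simpa using congrArg (fun p => p.1.length) h
  square {a b c d} hab hbc had hdc hac := by
    have h := (hG.subsingleton_path _ _).elim
      (⟨.cons hab (.cons hbc .nil), by simp [hab.ne, hbc.ne, hac]⟩ : G.Path a c)
      ⟨.cons had (.cons hdc .nil), by simp [had.ne, hdc.ne, hac]⟩
    simpa using congrArg (fun p => p.1.support) h

theorem exists_adj_notMem_of_connected (hG : G.Connected) (S : Set V) {u v : V} (hu : u ∈ S)
    (hv : v ∉ S) : ∃ x ∈ S, ∃ y ∉ S, G.Adj x y := by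
  obtain ⟨p⟩ := hG.preconnected u v
  obtain ⟨d, -, hd, hd'⟩ := p.exists_boundary_dart S hu hv
  exact ⟨d.fst, hd, d.snd, hd', d.adj⟩

/-- The relation "`v` dominates `u`". -/
def Dominates (G : SimpleGraph V) (v u : V) : Prop := u = v ∨ G.Adj v u

/-- A leaf `a` attached to `b`. -/
def IsLeafAt (G : SimpleGraph V) (a b : V) : Prop := ∀ u, G.Adj a u ↔ u = b

theorem exists_isLeafAt [Finite V] [Nontrivial V] (hG : G.IsTree) : ∃ a b, IsLeafAt G a b := by
  classical
  have := Fintype.ofFinite V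
  obtain ⟨a, ha⟩ := hG.exists_vert_degree_one_of_nontrivial
  obtain ⟨b, hb, hb'⟩ := SimpleGraph.degree_eq_one_iff_existsUnique_adj.1 ha
  exact ⟨a, b, fun u => ⟨hb' u, fun h => h ▸ hb⟩⟩

/-- The partner `w` of the leaf `a` dominates everything except possibly `a` and `b`. If it
dominates `b`, it serves; otherwise the graph is the path `a b c w`, and `c` serves. -/
theorem exists_dominates_all_but_one (hG : GirthAtLeastFive G) (hc : G.Connected) {a b : V}
    (hab : IsLeafAt G a b)
    (h : ∀ v, ∃ w, ∀ x, Dominates G v x ∨ Dominates G w x) :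
    ∃ v, ∀ x y, ¬ Dominates G v x → ¬ Dominates G v y → x = y := by
  have h3 := @hG.triangle
  have h4 := @hG.square
  have hla : ∀ u, G.Adj a u → u = b := fun u => (hab u).1
  have hla' : ∀ u, G.Adj u a → u = b := fun u hu => (hab u).1 hu.symm
  obtain ⟨w, hw⟩ := h a
  by_cases hbw : Dominates G w b
  · exact ⟨w, by grind [Dominates, IsLeafAt]⟩
  have hwa : w ≠ a := by grind [Dominates, IsLeafAt]
  have hwb : w ≠ b := by grind [Dominates, IsLeafAt]
  have hadj : G.Adj a b := (hab b).2 rfl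
  obtain ⟨b', hb', c, hcS, hbc⟩ :=
    exists_adj_notMem_of_connected hc {a, b} (u := a) (v := w) (by simp) (by simp [hwa, hwb])
  simp only [Set.mem_insert_iff, Set.mem_singleton_iff, not_or] at hb' hcS
  obtain rfl : b' = b := by grind [IsLeafAt]
  have hwc : G.Adj w c := by
    have := hw c
    grind [Dominates, IsLeafAt, G.adj_comm]
  refine ⟨c, ?_⟩
  -- The partner of `c` must dominate `a`, so it is `a` or `b'`; to dominate `d` as well it needs
  -- `b'` adjacent to `d`, which closes the four-cycle `b' d w c`.
  have key : ∀ d, G.Adj w d → d = c := by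
    intro d hd
    by_contra hdc
    obtain ⟨w', hw'⟩ := h c
    have hca : ¬ Dominates G c a := by grind [Dominates, IsLeafAt, G.adj_comm]
    have hcd : ¬ Dominates G c d := by grind [Dominates, G.adj_comm]
    have hwa' := (hw' a).resolve_left hca
    have hwd' := (hw' d).resolve_left hcd
    have hbd : ¬ G.Adj b' d := fun hbd => hdc (h4 hbd hd.symm hbc hwc.symm hwb.symm)
    have had : ¬ G.Adj a d := by grind [Dominates]
    have : w' = a ∨ w' = b' := by grind [Dominates, IsLeafAt, G.adj_comm]
    clear h4
    grind [Dominates, IsLeafAt, G.adj_comm]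
  intro x y hx hy
  have := hw x
  have := hw y
  have := key x
  have := key y
  grind [Dominates, IsLeafAt, G.adj_comm]

/-- If one vertex fails to dominate all ends of an induced pair of disjoint edges, then
no second vertex can leave at most one vertex undominated. -/
theorem false_of_induced_matching (hG : GirthAtLeastFive G)
    (h : ∀ v, ∃ w, ∀ x y, ¬ Dominates G v x → ¬ Dominates G w x → ¬ Dominates G v y →
      ¬ Dominates G w y → x = y)
    {v a b c d : V} (hab : G.Adj a b) (hcd : G.Adj c d)
    (hac : ¬ Dominates G a c) (had : ¬ Dominates G a d)
    (hbc : ¬ Dominates G b c) (hbd : ¬ Dominates G b d)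
    (ha : ¬ Dominates G v a) (hb : ¬ Dominates G v b)
    (hc : ¬ Dominates G v c) (hd : ¬ Dominates G v d) : False := by
  -- Missing at most one of the four ends, `w` dominates both ends of one edge. Without triangles it
  -- is one of those ends, and so misses the whole other edge.
  obtain ⟨w, hw⟩ := h v
  have h3 := @hG.triangle
  have e1 : Dominates G w a → Dominates G w b → w = a ∨ w = b := by
    grind [Dominates, G.adj_comm]
  have e2 : Dominates G w c → Dominates G w d → w = c ∨ w = d := by
    grind [Dominates, G.adj_comm]
  have n1 := fun h₁ => hw a c ha h₁ hc
  have n2 := fun h₁ => hw a d ha h₁ hd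
  have n3 := fun h₁ => hw b c hb h₁ hc
  have n4 := fun h₁ => hw b d hb h₁ hd
  have n5 := fun h₁ => hw a b ha h₁ hb
  have n6 := fun h₁ => hw c d hc h₁ hd
  have := hab.ne
  have := hcd.ne
  grind [Dominates, G.adj_comm]

/-- If no pair dominates, a vertex missed by a well-chosen pair yields the configuration excluded by
`false_of_induced_matching`. -/
theorem exists_dominating_pair (hG : GirthAtLeastFive G) (hc : G.Connected) {a b : V}
    (hab : IsLeafAt G a b)
    (h : ∀ v, ∃ w, ∀ x y, ¬ Dominates G v x → ¬ Dominates G w x → ¬ Dominates G v y →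
      ¬ Dominates G w y → x = y) :
    ∃ v w, ∀ x, Dominates G v x ∨ Dominates G w x := by
  by_contra! hno
  have h3 := @hG.triangle
  have h4 := @hG.square
  have hla : ∀ u, G.Adj a u → u = b := fun u => (hab u).1
  have hla' : ∀ u, G.Adj u a → u = b := fun u hu => (hab u).1 hu.symm
  have hadj : G.Adj a b := (hab b).2 rfl
  obtain ⟨w, hw⟩ := h a
  -- Since `b` dominates all that `a` does, `x` is the one vertex missed by `a` and `w`.
  obtain ⟨x, hbx, hwx⟩ := hno b w
  have hxa : x ≠ a := by grind [Dominates, G.adj_comm]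
  have hxb : x ≠ b := by grind [Dominates]
  have hax : ¬ Dominates G a x := by grind [Dominates, IsLeafAt]
  have hcov : ∀ u, u = a ∨ u = b ∨ u = x ∨ u = w ∨ G.Adj w u := by
    intro u
    have := fun h₁ h₂ => hw u x h₁ h₂ hax hwx
    grind [Dominates, IsLeafAt]
  have hwa : w ≠ a := by
    rintro rfl
    obtain ⟨y, hy, z, hz, hyz⟩ := exists_adj_notMem_of_connected hc {x} (u := x) (v := b)
      (by simp) (by simpa using hxb.symm)
    grind [Dominates, IsLeafAt, G.adj_comm]
  have hwb : w ≠ b := by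
    rintro rfl
    obtain ⟨y, hy, hy'⟩ := hno w x
    grind [Dominates, IsLeafAt, G.adj_comm]
  obtain ⟨x', hx', y, hyx, hxy⟩ := exists_adj_notMem_of_connected hc {x} (u := x) (v := a)
    (by simp) (by simpa using hxa.symm)
  simp only [Set.mem_singleton_iff] at hx' hyx
  subst hx'
  have hwy : G.Adj w y := by
    have := hcov y
    grind [Dominates, IsLeafAt, G.adj_comm]
  have hyb : y ≠ b := by grind [Dominates, G.adj_comm]
  have hya : y ≠ a := by grind [IsLeafAt, G.adj_comm]
  have hnwa : ¬ G.Adj w a := by grind [IsLeafAt, G.adj_comm]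
  -- A second neighbour of `x'` would also be adjacent to `w`, closing a four-cycle.
  have hxleaf : ∀ u, G.Adj x' u → u = y := by
    intro u hu
    have : G.Adj w u := by
      have := hcov u
      grind [Dominates, IsLeafAt, G.adj_comm]
    grind [Dominates, G.adj_comm]
  by_cases hbw : G.Adj w b
  · obtain ⟨l, hbl, hyl⟩ := hno b y
    have hwl : G.Adj w l := by
      have := hcov l
      grind [Dominates, G.adj_comm]
    refine false_of_induced_matching hG h (v := l) hadj hxy ?_ ?_ ?_ ?_ ?_ ?_ ?_ ?_ <;>
      grind [Dominates, IsLeafAt, G.adj_comm]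
  · obtain ⟨b', hb', c, hcS, hbc⟩ :=
      exists_adj_notMem_of_connected hc {a, b} (u := a) (v := w) (by simp) (by simp [hwa, hwb])
    simp only [Set.mem_insert_iff, Set.mem_singleton_iff, not_or] at hb' hcS
    obtain rfl : b' = b := by grind [IsLeafAt]
    have hwc : G.Adj w c := by
      have := hcov c
      grind [Dominates, IsLeafAt, G.adj_comm]
    obtain ⟨d, hbd, hyd⟩ := hno b' y
    have hwd : G.Adj w d := by
      have := hcov d
      grind [Dominates, G.adj_comm]
    have hnad : ¬ G.Adj a d := fun had => hbw (hla d had ▸ hwd)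
    have hnay : ¬ G.Adj a y := fun hay => hyb (hla y hay)
    have hnxd : ¬ G.Adj x' d := fun hxd => hyd (Or.inl (hxleaf d hxd))
    have hnxw : ¬ G.Adj x' w := fun hxw => hwx (Or.inr hxw.symm)
    by_cases hyc : y = c
    · clear h4
      refine false_of_induced_matching hG h (v := x') hadj hwd ?_ ?_ ?_ ?_ ?_ ?_ ?_ ?_ <;>
        grind [Dominates, IsLeafAt, G.adj_comm]
    · have hnby : ¬ G.Adj b' y := fun hby => hyc (h4 hby hwy.symm hbc hwc.symm hwb.symm)
      clear h4
      refine false_of_induced_matching hG h (v := d) hadj hxy ?_ ?_ ?_ ?_ ?_ ?_ ?_ ?_ <;>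
        grind [Dominates, IsLeafAt, G.adj_comm]

end Graph

/-! ### From game values to domination conditions and back -/

section Game

variable {V : Type*} [Fintype V] {G : SimpleGraph V}

theorem movesLeft_le_zero_iff (p : Player) (A : Finset V) :
    movesLeft G p A ≤ 0 ↔ A = Finset.univ := by
  rw [movesLeft]
  have := legalMoves_nonempty_iff G A
  split_ifs with h
  · cases p <;> simp [this.1 h]
  · simpa using not_not.1 (mt this.2 h)

theorem movesLeft_dominator_le_succ_iff (A : Finset V) (n : ℕ) :
    movesLeft G .dominator A ≤ n + 1 ↔
      A = Finset.univ ∨ ∃ v ∈ legalMoves G A, movesLeft G .staller (afterMove G A v) ≤ n := by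
  rw [movesLeft]
  have := legalMoves_nonempty_iff G A
  split_ifs with h
  · simp [this.1 h, add_comm 1, Finset.inf'_le_iff]
  · simp [not_not.1 (mt this.2 h)]

theorem movesLeft_staller_le_succ_iff (A : Finset V) (n : ℕ) :
    movesLeft G .staller A ≤ n + 1 ↔
      ∀ v ∈ legalMoves G A, movesLeft G .dominator (afterMove G A v) ≤ n := by
  rw [movesLeft]
  have := legalMoves_nonempty_iff G A
  split_ifs with h
  · simp [add_comm 1, Finset.sup'_le_iff]
  · simp [Finset.not_nonempty_iff_eq_empty.1 h]

theorem mem_closedNbhd_iff_dominates (v u : V) : u ∈ closedNbhd G v ↔ Dominates G v u :=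
  mem_closedNbhd G v u

theorem mem_legalMoves_iff (A : Finset V) (v : V) :
    v ∈ legalMoves G A ↔ ∃ u, Dominates G v u ∧ u ∉ A := by
  simp [mem_legalMoves, Finset.not_subset, mem_closedNbhd_iff_dominates]

theorem mem_afterMove_iff (A : Finset V) (v u : V) :
    u ∈ afterMove G A v ↔ u ∈ A ∨ Dominates G v u := by
  rw [mem_afterMove, mem_closedNbhd_iff_dominates]

theorem mem_legalMoves_empty (v : V) : v ∈ legalMoves G ∅ :=
  (mem_legalMoves_iff _ v).2 ⟨v, Or.inl rfl, by simp⟩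

/-- A first move `v` of Dominator bounds the length of the whole game. -/
theorem gameDominationNumber_le_succ {n : ℕ} (v : V)
    (h : movesLeft G .staller (afterMove G ∅ v) ≤ n) : gameDominationNumber G ≤ n + 1 :=
  (movesLeft_dominator_le_succ_iff _ _).2 (Or.inr ⟨v, mem_legalMoves_empty v, h⟩)

/-- Staller's reply, being legal, must dominate the only vertex that `v` misses. -/
theorem gameDominationNumber_le_two (v : V)
    (h : ∀ x y, ¬ Dominates G v x → ¬ Dominates G v y → x = y) :
    gameDominationNumber G ≤ 2 := by
  refine gameDominationNumber_le_succ v ((movesLeft_staller_le_succ_iff _ _).2 fun u hu => ?_)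
  rw [movesLeft_le_zero_iff, Finset.eq_univ_iff_forall]
  intro x
  obtain ⟨y, hy, hyA⟩ := (mem_legalMoves_iff _ u).1 hu
  have := h x y
  simp only [mem_afterMove_iff, Finset.notMem_empty, false_or] at hyA ⊢
  grind

/-- Dominator plays `v`, then `w` if the game is still on, whatever Staller does in between. -/
theorem gameDominationNumber_le_three (v w : V)
    (h : ∀ x, Dominates G v x ∨ Dominates G w x) : gameDominationNumber G ≤ 3 := by
  refine gameDominationNumber_le_succ v ((movesLeft_staller_le_succ_iff _ _).2 fun u _ => ?_)
  rw [movesLeft_dominator_le_succ_iff]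
  by_cases hA : afterMove G (afterMove G ∅ v) u = Finset.univ
  · exact Or.inl hA
  refine Or.inr ⟨w, ?_, ?_⟩
  · obtain ⟨x, hx⟩ := not_forall.1 (mt Finset.eq_univ_iff_forall.2 hA)
    refine (mem_legalMoves_iff _ w).2 ⟨x, ?_, hx⟩
    have := h x
    simp only [mem_afterMove_iff] at hx
    grind
  · rw [movesLeft_le_zero_iff, Finset.eq_univ_iff_forall]
    intro x
    have := h x
    simp only [mem_afterMove_iff]
    grind

theorem exists_dominates_of_stallerStart_le_two (h : stallerStartGameDominationNumber G ≤ 2)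
    (v : V) : ∃ w, ∀ x, Dominates G v x ∨ Dominates G w x := by
  have hv := (movesLeft_staller_le_succ_iff _ _).1 h v (mem_legalMoves_empty v)
  rw [movesLeft_dominator_le_succ_iff] at hv
  simp only [movesLeft_le_zero_iff, Finset.eq_univ_iff_forall, mem_afterMove_iff,
    Finset.notMem_empty, false_or] at hv
  obtain hv | ⟨w, -, hw⟩ := hv
  · exact ⟨v, fun x => Or.inl (hv x)⟩
  · exact ⟨w, hw⟩

theorem exists_almost_dominates_of_stallerStart_le_three (hG : GirthAtLeastFive G)
    (hc : G.Connected) (h : stallerStartGameDominationNumber G ≤ 3) (v : V) :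
    ∃ w, ∀ x y, ¬ Dominates G v x → ¬ Dominates G w x → ¬ Dominates G v y →
      ¬ Dominates G w y → x = y := by
  have hv := (movesLeft_staller_le_succ_iff _ _).1 h v (mem_legalMoves_empty v)
  rw [movesLeft_dominator_le_succ_iff] at hv
  simp only [movesLeft_staller_le_succ_iff, movesLeft_le_zero_iff, Finset.eq_univ_iff_forall,
    mem_afterMove_iff, mem_legalMoves_iff, Finset.notMem_empty, false_or] at hv
  obtain hv | ⟨w, -, hw⟩ := hv
  · exact ⟨v, fun x _ hx => absurd (hv x) hx⟩
  refine ⟨w, fun x y hvx hwx hvy hwy => ?_⟩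
  by_contra hxy
  -- Any legal third move ends the game, so it dominates both `x` and `y`. Hence `x` and `y` are
  -- adjacent, and by connectedness an outside neighbour of one of them makes a triangle.
  have key : ∀ u, Dominates G u x ∨ Dominates G u y → Dominates G u x ∧ Dominates G u y := by
    intro u hu
    have hu' : ∃ z, Dominates G u z ∧ ¬ (Dominates G v z ∨ Dominates G w z) := by grind
    have := hw u hu'
    grind
  obtain ⟨s, hs, z, hz, hsz⟩ := exists_adj_notMem_of_connected hc {x, y} (u := x) (v := v)
    (by simp) (by grind [Dominates])
  have h3 := @hG.triangle
  have hkx := key x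
  have hkz := key z
  grind [Dominates, G.adj_comm]

theorem gameDominationNumber_le_two_of_stallerStart (hT : G.IsTree)
    (h : stallerStartGameDominationNumber G ≤ 2) : gameDominationNumber G ≤ 2 := by
  obtain hV | hV := subsingleton_or_nontrivial V
  · obtain ⟨v⟩ := hT.1.nonempty
    exact gameDominationNumber_le_two v fun x y _ _ => Subsingleton.elim x y
  · obtain ⟨a, b, hab⟩ := exists_isLeafAt hT
    obtain ⟨v, hv⟩ := exists_dominates_all_but_one (girthAtLeastFive_of_isAcyclic hT.2) hT.1 hab
      (exists_dominates_of_stallerStart_le_two h)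
    exact gameDominationNumber_le_two v hv

theorem gameDominationNumber_le_three_of_stallerStart (hT : G.IsTree)
    (h : stallerStartGameDominationNumber G ≤ 3) : gameDominationNumber G ≤ 3 := by
  obtain hV | hV := subsingleton_or_nontrivial V
  · obtain ⟨v⟩ := hT.1.nonempty
    exact gameDominationNumber_le_three v v fun x => Or.inl (Or.inl (Subsingleton.elim x v))
  · obtain ⟨a, b, hab⟩ := exists_isLeafAt hT
    have hG := girthAtLeastFive_of_isAcyclic hT.2
    obtain ⟨v, w, hvw⟩ := exists_dominating_pair hG hT.1 hab
      (exists_almost_dominates_of_stallerStart_le_three hG hT.1 h)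
    exact gameDominationNumber_le_three v w hvw

end Game

end DominationGame

theorem mainTheorem6 {V : Type*} [Fintype V] (T : SimpleGraph V) (hT : T.IsTree) :
    ¬ DominationGame.Realizes T 3 2 ∧ ¬ DominationGame.Realizes T 4 3 := by
  constructor
  · rintro ⟨h, h'⟩
    have := DominationGame.gameDominationNumber_le_two_of_stallerStart hT h'.le
    omega
  · rintro ⟨h, h'⟩
    have := DominationGame.gameDominationNumber_le_three_of_stallerStart hT h'.le
    omega
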